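/- Let $(M,\kappa)$ be a symplectic manifold of dimension $2n$ (so $\kappa$ is a smooth, closed, non-degenerate 2-form), and let $J$ be a $\kappa$-calibrated complex structure on $M$, i.e. a smooth section of $\mathrm{End}(TM)$, not assumed integrable, with $J^2=-\mathrm{Id}$, $\kappa(J\cdot,J\cdot)=\kappa(\cdot,\cdot)$ and $g:=\kappa(J\cdot,\cdot)$ positive definite. Let $\nabla$ be the Levi-Civita connection of $g$ and $R(X,Y)=[\nabla_X,\nabla_Y]-\nabla_{[X,Y]}$ its curvature. Extend $\nabla$, $R$, $J$ and the bracket complex-linearly to smooth sections of $TM\otimes\mathbb{C}$, write $(\nabla_XJ)Y=\nabla_X(JY)-J\nabla_XY$, and let $B$ be the tensor $$B(X,Y)=J(\nabla_XJ)Y-(\nabla_{JX}J)Y .$$ Let $\nabla''$ be the $(0,1)$-part of $\nabla$, $\nabla''_X:=\nabla_{X^{(0,1)}}$ with $X^{(0,1)}=\tfrac12(X+iJX)$. A smooth complex vector field $Z$ is of type $(1,0)$ if $JZ=iZ$. Then the following are equivalent: 1. $\nabla''B=0$; 2. for all vector fields $Z,W,H$ of type $(1,0)$, $$R(\overline Z,W)H=-i\nabla_{\overline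 Z}(J\nabla_WH)+iJ\nabla_W\nabla_{\overline Z}H+iJ\nabla_{\nabla_{\overline Z}W}H+\nabla_{\nabla_W\overline Z}H ;$$ 3. for all vector fields $Z,W,H$ of type $(1,0)$, $(\nabla_{\overline Z}J)(\nabla_WH)=0$. -/

import Mathlib

open scoped Manifold ContDiff Bundle TensorProduct

noncomputable section

namespace Symplectic

section Defs

variable {E : Type*} [NormedAddCommGroup E] [NormedSpace ℝ E]
  {M : Type*} [TopologicalSpace M] [ChartedSpace E M] [IsManifold 𝓘(ℝ, E) ∞ M]

/-! ### Real vector fields, symplectic forms, calibrated complex structures -/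

/-- Real vector fields on `M`, with no regularity imposed. -/
abbrev VField (E : Type*) [NormedAddCommGroup E] [NormedSpace ℝ E]
    (M : Type*) [TopologicalSpace M] [ChartedSpace E M] : Type _ :=
  (p : M) → TangentSpace 𝓘(ℝ, E) p

/-- The vector field `X` is smooth. -/
def IsSmoothField (X : VField E M) : Prop :=
  ContMDiff 𝓘(ℝ, E) 𝓘(ℝ, E).tangent ∞ (fun p ↦ (⟨p, X p⟩ : TangentBundle 𝓘(ℝ, E) M))

/-- Lie bracket of real vector fields. -/
def bracket (X Y : VField E M) : VField E M := VectorField.mlieBracket 𝓘(ℝ, E) X Y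

/-- The derivative `X f` of a real function `f` along the vector field `X`. -/
def dirDeriv (X : VField E M) (f : M → ℝ) (p : M) : ℝ := mvfderiv 𝓘(ℝ, E) f p (X p)

/-- A field of bilinear forms on the tangent spaces of `M`. -/
abbrev BilinField (E : Type*) [NormedAddCommGroup E] [NormedSpace ℝ E]
    (M : Type*) [TopologicalSpace M] [ChartedSpace E M] : Type _ :=
  (p : M) → TangentSpace 𝓘(ℝ, E) p →L[ℝ] TangentSpace 𝓘(ℝ, E) p →L[ℝ] ℝ

/-- Exterior derivative of a 2-form, evaluated on three vector fields. -/
def extDerivTwo (α : BilinField E M) (X Y Z : VField E M) (p : M) : ℝ :=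
  dirDeriv X (fun q ↦ α q (Y q) (Z q)) p
    - dirDeriv Y (fun q ↦ α q (X q) (Z q)) p
    + dirDeriv Z (fun q ↦ α q (X q) (Y q)) p
    - α p (bracket X Y p) (Z p)
    + α p (bracket X Z p) (Y p)
    - α p (bracket Y Z p) (X p)

/-- `κ` is a symplectic form on `M`: a smooth, closed, non-degenerate 2-form. -/
structure IsSymplectic (κ : BilinField E M) : Prop where
  smooth : ContMDiff 𝓘(ℝ, E) (𝓘(ℝ, E).prod 𝓘(ℝ, E →L[ℝ] E →L[ℝ] ℝ)) ∞
    (fun p ↦ Bundle.TotalSpace.mk' (E →L[ℝ] E →L[ℝ] ℝ)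
      (E := fun p : M ↦ TangentSpace 𝓘(ℝ, E) p →L[ℝ] TangentSpace 𝓘(ℝ, E) p →L[ℝ] ℝ) p (κ p))
  alternating : ∀ (p : M) (v : TangentSpace 𝓘(ℝ, E) p), κ p v v = 0
  nondegenerate : ∀ (p : M) (v : TangentSpace 𝓘(ℝ, E) p), (∀ w, κ p v w = 0) → v = 0
  closed : ∀ X Y Z : VField E M, IsSmoothField X → IsSmoothField Y → IsSmoothField Z →
    ∀ p, extDerivTwo κ X Y Z p = 0

/-- A field of endomorphisms of the tangent spaces of `M`. -/
abbrev EndField (E : Type*) [NormedAddCommGroup E] [NormedSpace ℝ E]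
    (M : Type*) [TopologicalSpace M] [ChartedSpace E M] : Type _ :=
  (p : M) → TangentSpace 𝓘(ℝ, E) p →L[ℝ] TangentSpace 𝓘(ℝ, E) p

/-- The bilinear form `g_J = κ(J ·, ·)`. -/
def calibratedMetric (κ : BilinField E M) (J : EndField E M) : BilinField E M :=
  fun p ↦ (κ p).comp (J p)

/-- `J` is a `κ`-calibrated complex structure: a smooth section of `End(TM)` with `J² = -1`
(no integrability is required), such that `κ` is `J`-invariant and `κ(J ·, ·)` is positive
definite. -/
structure IsCalibrated (κ : BilinField E M) (J : EndField E M) :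
    Prop where
  smooth : ContMDiff 𝓘(ℝ, E) (𝓘(ℝ, E).prod 𝓘(ℝ, E →L[ℝ] E)) ∞
    (fun p ↦ Bundle.TotalSpace.mk' (E →L[ℝ] E)
      (E := fun p : M ↦ TangentSpace 𝓘(ℝ, E) p →L[ℝ] TangentSpace 𝓘(ℝ, E) p) p (J p))
  square : ∀ (p : M) (v : TangentSpace 𝓘(ℝ, E) p), J p (J p v) = -v
  invariant : ∀ (p : M) (v w : TangentSpace 𝓘(ℝ, E) p), κ p (J p v) (J p w) = κ p v w
  positive : ∀ (p : M) (v : TangentSpace 𝓘(ℝ, E) p), v ≠ 0 → 0 < calibratedMetric κ J p v v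

/-! ### The Levi-Civita connection -/

/-- Connections on the tangent bundle of `M`. -/
abbrev Connection (E : Type*) [NormedAddCommGroup E] [NormedSpace ℝ E]
    (M : Type*) [TopologicalSpace M] [ChartedSpace E M]
    [IsManifold 𝓘(ℝ, E) ∞ M] : Type _ :=
  CovariantDerivative 𝓘(ℝ, E) E (TangentSpace 𝓘(ℝ, E) : M → Type _)

/-- The vector field `∇_X Y`. -/
def nabla (D : Connection E M) (X Y : VField E M) : VField E M :=
  fun p ↦ D Y p (X p)

/-- `D` is the Levi-Civita connection of the metric `g`: the smooth connection on `TM` which is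
torsion-free and compatible with `g`. -/
structure IsLeviCivita (g : BilinField E M) (D : Connection E M) :
    Prop where
  smooth : ∀ X Y : VField E M, IsSmoothField X → IsSmoothField Y → IsSmoothField (nabla D X Y)
  torsionFree : ∀ X Y : VField E M, IsSmoothField X → IsSmoothField Y →
    nabla D X Y - nabla D Y X = bracket X Y
  metric : ∀ X Y Z : VField E M, IsSmoothField X → IsSmoothField Y → IsSmoothField Z →
    ∀ p, dirDeriv X (fun q ↦ g q (Y q) (Z q)) p
      = g p (nabla D X Y p) (Z p) + g p (Y p) (nabla D X Z p)

/-! ### Complex vector fields -/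

/-- The real part of a complexified vector. -/
def rePart {V : Type*} [AddCommGroup V] [Module ℝ V] : ℂ ⊗[ℝ] V →ₗ[ℝ] V :=
  (TensorProduct.lid ℝ V).toLinearMap ∘ₗ Complex.reLm.rTensor V

/-- The imaginary part of a complexified vector. -/
def imPart {V : Type*} [AddCommGroup V] [Module ℝ V] : ℂ ⊗[ℝ] V →ₗ[ℝ] V :=
  (TensorProduct.lid ℝ V).toLinearMap ∘ₗ Complex.imLm.rTensor V

/-- Conjugation of complexified vectors. -/
def conjVec {V : Type*} [AddCommGroup V] [Module ℝ V] : ℂ ⊗[ℝ] V →ₗ[ℝ] ℂ ⊗[ℝ] V :=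
  Complex.conjAe.toLinearMap.rTensor V

/-- Complex vector fields on `M`, i.e. sections of `TM ⊗ ℂ`, with no regularity imposed. -/
abbrev CField (E : Type*) [NormedAddCommGroup E] [NormedSpace ℝ E]
    (M : Type*) [TopologicalSpace M] [ChartedSpace E M] : Type _ :=
  (p : M) → ℂ ⊗[ℝ] TangentSpace 𝓘(ℝ, E) p

namespace CField

/-- The real part of a complex vector field. -/
def re (Z : CField E M) : VField E M := fun p ↦ rePart (Z p)

/-- The imaginary part of a complex vector field. -/
def im (Z : CField E M) : VField E M := fun p ↦ imPart (Z p)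

/-- The complex vector field `X + iY`. -/
def mk (X Y : VField E M) : CField E M :=
  fun p ↦ (1 : ℂ) ⊗ₜ[ℝ] X p + Complex.I ⊗ₜ[ℝ] Y p

/-- The complex vector field `Z` is smooth. -/
def IsSmooth (Z : CField E M) : Prop := IsSmoothField Z.re ∧ IsSmoothField Z.im

/-- The conjugate field. -/
def conj (Z : CField E M) : CField E M := fun p ↦ conjVec (Z p)

end CField

/-- The extension of a (bilinear) operation on real vector fields to complex vector fields. -/
def complexExt (F : VField E M → VField E M → VField E M) (Z W : CField E M) : CField E M :=
  CField.mk (F Z.re W.re - F Z.im W.im) (F Z.re W.im + F Z.im W.re)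

/-- The bracket of complex vector fields. -/
def cbracket (Z W : CField E M) : CField E M := complexExt bracket Z W

/-- The `ℂ`-linear extension of `J`, acting on complex vector fields. -/
def cJ (J : EndField E M) (Z : CField E M) : CField E M :=
  fun p ↦ (J p).toLinearMap.baseChange ℂ (Z p)

/-- `Z` is a smooth vector field of type `(1,0)`. -/
def IsOneZero (J : EndField E M) (Z : CField E M) : Prop :=
  Z.IsSmooth ∧ ∀ p, cJ J Z p = Complex.I • Z p

/-- The `(0,1)`-part of a complex vector field. -/
def zeroOnePart (J : EndField E M) (Z : CField E M) : CField E M :=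
  (1 / 2 : ℂ) • (Z + Complex.I • cJ J Z)

/-- `∇_Z W` for complex vector fields. -/
def cnabla (D : Connection E M) (Z W : CField E M) : CField E M := complexExt (nabla D) Z W

/-- The curvature `R(Z,W)H = ∇_Z ∇_W H - ∇_W ∇_Z H - ∇_{[Z,W]} H`. -/
def curvature (D : Connection E M) (Z W H : CField E M) : CField E M :=
  cnabla D Z (cnabla D W H) - cnabla D W (cnabla D Z H) - cnabla D (cbracket Z W) H

/-- `(∇_Z J) W`. -/
def nablaJ (D : Connection E M) (J : EndField E M) (Z W : CField E M) : CField E M :=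
  cnabla D Z (cJ J W) - cJ J (cnabla D Z W)

/-- The tensor `B(Z,W) = J(∇_Z J)W - (∇_{JZ} J)W`. -/
def tensorB (D : Connection E M) (J : EndField E M) (Z W : CField E M) : CField E M :=
  cJ J (nablaJ D J Z W) - nablaJ D J (cJ J Z) W

/-- `(∇_U B)(Z,W)`. -/
def nablaB (D : Connection E M) (J : EndField E M) (U Z W : CField E M) : CField E M :=
  cnabla D U (tensorB D J Z W) - tensorB D J (cnabla D U Z) W - tensorB D J Z (cnabla D U W)

/-- `∇''B = 0`, where `∇''_U = ∇_{U^{(0,1)}}`. -/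
def NablaBarBVanishes (D : Connection E M) (J : EndField E M) : Prop :=
  ∀ U Z W : CField E M, U.IsSmooth → Z.IsSmooth → W.IsSmooth →
    nablaB D J (zeroOnePart J U) Z W = 0

end Defs

end Symplectic

end

/-! Each of the three conditions is equivalent to `∇J = 0`, that is, to `g` being Kähler.

Closedness of `κ` gives the almost Kähler identity `∇_{JX}J = -J ∇_X J` (`nablaEnd_apply_left`),
while `J² = -1` makes `∇_X J` anticommute with `J`. Hence, for `Z` of type (1,0), `∇_{Z̄}J` takes
values in type (1,0), kills type (1,0), and sees only the (0,1)-part of its argument; in particular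
`∇_{Z̄}` preserves type (1,0). Likewise `∇_Z J` takes values in type (0,1).

From 3 to `∇J = 0`: take `Z = W = X - iJX` and `H = Y - iJY`. In the real part of condition 3 the
terms still involving derivatives of `Y` cancel, leaving `J(∇_X J)²Y = 0`. Since `∇_X J` is `g`-skew
and `g` is positive definite, `(∇_X J)Y = 0` (`nablaEnd_eq_zero`, `nablaJ_eq_zero`). Once `J` is
parallel, 1 and 2 are formal.

From 1 or 2 to 3: up to a factor, the (0,1)-part of `∇_W H` is `(∇_W J)H`. Either condition says
that `∇_{Z̄}` of this part is again of type (0,1), so `∇_{Z̄}J` annihilates it, and hence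
annihilates `∇_W H`. -/

noncomputable section

namespace Symplectic

section RealFields

variable {E : Type*} [NormedAddCommGroup E] [NormedSpace ℝ E]
  {M : Type*} [TopologicalSpace M] [ChartedSpace E M]

/-! ### Real vector fields -/

/-- A field of endomorphisms applied to a vector field. -/
def EndField.apply (J : EndField E M) (X : VField E M) : VField E M := fun p ↦ J p (X p)

lemma EndField.apply_add (J : EndField E M) (X Y : VField E M) :
    J.apply (X + Y) = J.apply X + J.apply Y := by
  funext p; exact map_add (J p) _ _

lemma EndField.apply_neg (J : EndField E M) (X : VField E M) :
    J.apply (-X) = -J.apply X := by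
  funext p; exact map_neg (J p) _

lemma EndField.apply_sub (J : EndField E M) (X Y : VField E M) :
    J.apply (X - Y) = J.apply X - J.apply Y := by
  funext p; exact map_sub (J p) _ _

lemma EndField.apply_zero (J : EndField E M) : J.apply 0 = 0 := by
  funext p; exact map_zero (J p)

variable [IsManifold 𝓘(ℝ, E) ∞ M]
  {κ : BilinField E M} {J : EndField E M} {D : Connection E M}

lemma IsSmoothField.add {X Y : VField E M} (hX : IsSmoothField X) (hY : IsSmoothField Y) :
    IsSmoothField (X + Y) :=
  ContMDiff.add_section hX hY

lemma IsSmoothField.neg {X : VField E M} (hX : IsSmoothField X) : IsSmoothField (-X) :=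
  ContMDiff.neg_section hX

lemma IsSmoothField.sub {X Y : VField E M} (hX : IsSmoothField X) (hY : IsSmoothField Y) :
    IsSmoothField (X - Y) :=
  ContMDiff.sub_section hX hY

lemma IsSmoothField.smul (a : ℝ) {X : VField E M} (hX : IsSmoothField X) :
    IsSmoothField (a • X) :=
  ContMDiff.const_smul_section hX

lemma IsSmoothField.mdifferentiableAt {X : VField E M} (hX : IsSmoothField X) (p : M) :
    MDifferentiableAt 𝓘(ℝ, E) 𝓘(ℝ, E).tangent
      (fun p ↦ (⟨p, X p⟩ : TangentBundle 𝓘(ℝ, E) M)) p :=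
  (ContMDiff.mdifferentiable hX (by simp)) p

lemma IsCalibrated.apply_apply (hJ : IsCalibrated κ J) (X : VField E M) :
    J.apply (J.apply X) = -X := by
  funext p; exact hJ.square p _

lemma IsCalibrated.smooth_apply (hJ : IsCalibrated κ J) {X : VField E M}
    (hX : IsSmoothField X) : IsSmoothField (J.apply X) :=
  fun p ↦ ContMDiffAt.clm_bundle_apply (hJ.smooth p) (hX p)

lemma nabla_neg_left (D : Connection E M) (X Y : VField E M) :
    nabla D (-X) Y = -nabla D X Y := by
  funext p; exact map_neg (D Y p) _

lemma nabla_sub_left (D : Connection E M) (X X' Y : VField E M) :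
    nabla D (X - X') Y = nabla D X Y - nabla D X' Y := by
  funext p; exact map_sub (D Y p) _ _

lemma nabla_add_right (D : Connection E M) (X : VField E M) {Y Y' : VField E M}
    (hY : IsSmoothField Y) (hY' : IsSmoothField Y') :
    nabla D X (Y + Y') = nabla D X Y + nabla D X Y' := by
  funext p
  exact congrArg (fun L ↦ L (X p))
    (D.isCovariantDerivativeOnUniv.add (hY.mdifferentiableAt p) (hY'.mdifferentiableAt p))

lemma nabla_smul_right (D : Connection E M) (X : VField E M) (a : ℝ) {Y : VField E M}
    (hY : IsSmoothField Y) : nabla D X (a • Y) = a • nabla D X Y := by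
  funext p
  exact congrArg (fun L ↦ L (X p))
    (D.isCovariantDerivativeOnUniv.smul_const a (hY.mdifferentiableAt p))

lemma nabla_neg_right (D : Connection E M) (X : VField E M) {Y : VField E M}
    (hY : IsSmoothField Y) : nabla D X (-Y) = -nabla D X Y := by
  have := nabla_smul_right D X (-1) hY
  rwa [neg_one_smul, neg_one_smul] at this

lemma nabla_sub_right (D : Connection E M) (X : VField E M) {Y Y' : VField E M}
    (hY : IsSmoothField Y) (hY' : IsSmoothField Y') :
    nabla D X (Y - Y') = nabla D X Y - nabla D X Y' := by
  rw [sub_eq_add_neg, nabla_add_right D X hY hY'.neg, nabla_neg_right D X hY', sub_eq_add_neg]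

/-- The vector field `(∇_X J) Y`, for real `X` and `Y`. -/
def nablaEnd (D : Connection E M) (J : EndField E M) (X Y : VField E M) : VField E M :=
  nabla D X (J.apply Y) - J.apply (nabla D X Y)

lemma nabla_apply (D : Connection E M) (J : EndField E M) (X Y : VField E M) :
    nabla D X (J.apply Y) = nablaEnd D J X Y + J.apply (nabla D X Y) := by
  simp [nablaEnd]

lemma nablaEnd_add_right (hJ : IsCalibrated κ J) (D : Connection E M) (X : VField E M)
    {Y Y' : VField E M} (hY : IsSmoothField Y) (hY' : IsSmoothField Y') :
    nablaEnd D J X (Y + Y') = nablaEnd D J X Y + nablaEnd D J X Y' := by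
  simp only [nablaEnd, EndField.apply_add, nabla_add_right D X hY hY',
    nabla_add_right D X (hJ.smooth_apply hY) (hJ.smooth_apply hY')]
  abel

lemma nablaEnd_neg_right (hJ : IsCalibrated κ J) (D : Connection E M) (X : VField E M)
    {Y : VField E M} (hY : IsSmoothField Y) :
    nablaEnd D J X (-Y) = -nablaEnd D J X Y := by
  simp only [nablaEnd, EndField.apply_neg, nabla_neg_right D X hY,
    nabla_neg_right D X (hJ.smooth_apply hY)]
  abel

lemma nablaEnd_sub_right (hJ : IsCalibrated κ J) (D : Connection E M) (X : VField E M)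
    {Y Y' : VField E M} (hY : IsSmoothField Y) (hY' : IsSmoothField Y') :
    nablaEnd D J X (Y - Y') = nablaEnd D J X Y - nablaEnd D J X Y' := by
  rw [sub_eq_add_neg, nablaEnd_add_right hJ D X hY hY'.neg, nablaEnd_neg_right hJ D X hY',
    sub_eq_add_neg]

/-- Differentiating `J² = -1` makes `∇_X J` anticommute with `J`. -/
lemma nablaEnd_apply_right (hJ : IsCalibrated κ J) (D : Connection E M) (X : VField E M)
    {Y : VField E M} (hY : IsSmoothField Y) :
    nablaEnd D J X (J.apply Y) = -J.apply (nablaEnd D J X Y) := by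
  simp only [nablaEnd, hJ.apply_apply, nabla_neg_right D X hY, EndField.apply_sub]
  abel

end RealFields

section AlmostKaehlerIdentities

variable {E : Type*} [NormedAddCommGroup E] [NormedSpace ℝ E]
  {M : Type*} [TopologicalSpace M] [ChartedSpace E M]

lemma calibratedMetric_apply (κ : BilinField E M) (J : EndField E M) (p : M)
    (v w : TangentSpace 𝓘(ℝ, E) p) : calibratedMetric κ J p v w = κ p (J p v) w := rfl

variable [IsManifold 𝓘(ℝ, E) ∞ M]
  {κ : BilinField E M} {J : EndField E M} {D : Connection E M}

/-! ### The covariant derivative of `J` on an almost Kähler manifold -/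

lemma IsSymplectic.skew (hκ : IsSymplectic κ) (p : M) (v w : TangentSpace 𝓘(ℝ, E) p) :
    κ p v w = -κ p w v := by
  have h := hκ.alternating p (v + w)
  simp only [map_add, add_apply, hκ.alternating] at h
  linarith

lemma calibratedMetric_symm (hκ : IsSymplectic κ) (hJ : IsCalibrated κ J) (p : M)
    (v w : TangentSpace 𝓘(ℝ, E) p) :
    calibratedMetric κ J p v w = calibratedMetric κ J p w v := by
  have h := hJ.invariant p v (J p w)
  rw [hJ.square, map_neg] at h
  rw [calibratedMetric_apply, calibratedMetric_apply, hκ.skew p (J p w) v, ← h, neg_neg]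

lemma calibratedMetric_invariant (hJ : IsCalibrated κ J) (p : M)
    (v w : TangentSpace 𝓘(ℝ, E) p) :
    calibratedMetric κ J p (J p v) (J p w) = calibratedMetric κ J p v w :=
  hJ.invariant p (J p v) w

lemma calibratedMetric_apply_left (hJ : IsCalibrated κ J) (p : M)
    (v w : TangentSpace 𝓘(ℝ, E) p) :
    calibratedMetric κ J p (J p v) w = -calibratedMetric κ J p v (J p w) := by
  rw [← calibratedMetric_invariant hJ p (J p v) w, hJ.square, map_neg, neg_apply]

lemma symplectic_eq_metric (hJ : IsCalibrated κ J) (p : M) (v w : TangentSpace 𝓘(ℝ, E) p) :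
    κ p v w = calibratedMetric κ J p v (J p w) :=
  (hJ.invariant p v w).symm

/-- `J` is both orthogonal and skew for `g`, and the metric is parallel, so the derivative of `J` is
skew as well. -/
lemma metric_nablaEnd_skew (hJ : IsCalibrated κ J)
    (hD : IsLeviCivita (calibratedMetric κ J) D) {X Y Z : VField E M}
    (hX : IsSmoothField X) (hY : IsSmoothField Y) (hZ : IsSmoothField Z) (p : M) :
    calibratedMetric κ J p (nablaEnd D J X Y p) (Z p)
      = -calibratedMetric κ J p (Y p) (nablaEnd D J X Z p) := by
  have hJY := hJ.smooth_apply hY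
  have h1 := hD.metric X _ _ hX (hJ.smooth_apply hJY) (hJ.smooth_apply hZ) p
  have h2 := hD.metric X _ _ hX hJY hZ p
  rw [nabla_apply, nabla_apply D J X Z, nablaEnd_apply_right hJ D X hY] at h1
  -- The functions differentiated in `h1` and `h2` coincide because `J` is an isometry; comparing
  -- the two derivatives gives the claim.
  have h3 : (fun q ↦ calibratedMetric κ J q (J.apply (J.apply Y) q) (J.apply Z q))
      = fun q ↦ calibratedMetric κ J q (J.apply Y q) (Z q) :=
    funext fun q ↦ calibratedMetric_invariant hJ q _ _
  rw [h3, h2] at h1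
  simp only [Pi.add_apply, Pi.neg_apply, map_add, map_neg, add_apply, neg_apply, EndField.apply,
    calibratedMetric_invariant hJ, hJ.square] at h1
  have h4 := calibratedMetric_apply_left hJ p (Y p) (nabla D X Z p)
  linarith

/-- Since `κ = g(·, J·)` and `g` is parallel, `(∇_X κ)(Y,Z) = g(Y, (∇_X J)Z)`. -/
lemma dirDeriv_symplectic (hJ : IsCalibrated κ J)
    (hD : IsLeviCivita (calibratedMetric κ J) D) {X Y Z : VField E M}
    (hX : IsSmoothField X) (hY : IsSmoothField Y) (hZ : IsSmoothField Z) (p : M) :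
    dirDeriv X (fun q ↦ κ q (Y q) (Z q)) p
      = κ p (nabla D X Y p) (Z p) + κ p (Y p) (nabla D X Z p)
        + calibratedMetric κ J p (Y p) (nablaEnd D J X Z p) := by
  have h := hD.metric X _ _ hX hY (hJ.smooth_apply hZ) p
  have h3 : (fun q ↦ κ q (Y q) (Z q))
      = fun q ↦ calibratedMetric κ J q (Y q) (J.apply Z q) :=
    funext fun q ↦ symplectic_eq_metric hJ q _ _
  rw [nabla_apply] at h
  rw [h3, h, symplectic_eq_metric hJ, symplectic_eq_metric hJ]
  simp only [Pi.add_apply, map_add, EndField.apply]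
  ring

/-- For a torsion-free connection `dκ` is the cyclic sum of `∇κ`, so this is `dκ = 0` rewritten in
terms of `∇J`. -/
lemma metric_nablaEnd_cyclic (hκ : IsSymplectic κ) (hJ : IsCalibrated κ J)
    (hD : IsLeviCivita (calibratedMetric κ J) D) {X Y Z : VField E M}
    (hX : IsSmoothField X) (hY : IsSmoothField Y) (hZ : IsSmoothField Z) (p : M) :
    calibratedMetric κ J p (nablaEnd D J X Y p) (Z p)
      + calibratedMetric κ J p (nablaEnd D J Y Z p) (X p)
      + calibratedMetric κ J p (nablaEnd D J Z X p) (Y p) = 0 := by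
  have h := hκ.closed X Y Z hX hY hZ p
  rw [extDerivTwo, ← hD.torsionFree X Y hX hY, ← hD.torsionFree X Z hX hZ,
    ← hD.torsionFree Y Z hY hZ, dirDeriv_symplectic hJ hD hX hY hZ,
    dirDeriv_symplectic hJ hD hY hX hZ, dirDeriv_symplectic hJ hD hZ hX hY] at h
  simp only [Pi.sub_apply, map_sub, sub_apply] at h
  have e1 := metric_nablaEnd_skew hJ hD hX hY hZ p
  have e2 := metric_nablaEnd_skew hJ hD hY hZ hX p
  have e3 := metric_nablaEnd_skew hJ hD hZ hX hY p
  have e4 := metric_nablaEnd_skew hJ hD hY hX hZ p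
  have e5 := calibratedMetric_symm hκ hJ p (nablaEnd D J Y Z p) (X p)
  have k1 := hκ.skew p (X p) (nabla D Y Z p)
  have k2 := hκ.skew p (X p) (nabla D Z Y p)
  have k3 := hκ.skew p (Y p) (nabla D X Z p)
  have k4 := hκ.skew p (Y p) (nabla D Z X p)
  linarith

lemma smooth_nablaEnd (hJ : IsCalibrated κ J)
    (hD : IsLeviCivita (calibratedMetric κ J) D) {X Y : VField E M}
    (hX : IsSmoothField X) (hY : IsSmoothField Y) : IsSmoothField (nablaEnd D J X Y) :=
  (hD.smooth X _ hX (hJ.smooth_apply hY)).sub (hJ.smooth_apply (hD.smooth X Y hX hY))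

/-- A skew endomorphism `A` satisfies `g(AY, AY) = -g(A²Y, Y)`. -/
lemma nablaEnd_eq_zero_of_sq (hJ : IsCalibrated κ J)
    (hD : IsLeviCivita (calibratedMetric κ J) D) {X Y : VField E M}
    (hX : IsSmoothField X) (hY : IsSmoothField Y)
    (h : nablaEnd D J X (nablaEnd D J X Y) = 0) : nablaEnd D J X Y = 0 := by
  funext p
  have h1 := metric_nablaEnd_skew hJ hD hX (smooth_nablaEnd hJ hD hX hY) hY p
  rw [h] at h1
  by_contra hne
  have := hJ.positive p _ hne
  simp only [Pi.zero_apply, map_zero, zero_apply] at h1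
  linarith

/-- The only consequence of `dκ = 0` used later. It amounts to `S = (∇_X J)Y + (∇_{JX} J)(JY)` being
zero, which follows by testing `S` against itself. -/
lemma nablaEnd_apply_left (hκ : IsSymplectic κ) (hJ : IsCalibrated κ J)
    (hD : IsLeviCivita (calibratedMetric κ J) D) {X Y : VField E M}
    (hX : IsSmoothField X) (hY : IsSmoothField Y) :
    nablaEnd D J (J.apply X) Y = -J.apply (nablaEnd D J X Y) := by
  have hJX := hJ.smooth_apply hX
  have hJY := hJ.smooth_apply hY
  set S : VField E M := nablaEnd D J X Y + nablaEnd D J (J.apply X) (J.apply Y) with hS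
  have hSs : IsSmoothField S :=
    (smooth_nablaEnd hJ hD hX hY).add (smooth_nablaEnd hJ hD hJX hJY)
  have hJS := hJ.smooth_apply hSs
  have hS0 : S = 0 := by
    funext p
    by_contra hne
    have hpos := hJ.positive p _ hne
    -- In `c0 - c1 + c2 + c3` the terms differentiating `J` along `Y`, `JY`, `S` and `JS` cancel,
    -- leaving `2 g(S,S) = 0`.
    have c0 := metric_nablaEnd_cyclic hκ hJ hD hX hY hSs p
    have c1 := metric_nablaEnd_cyclic hκ hJ hD hX hJY hJS p
    have c2 := metric_nablaEnd_cyclic hκ hJ hD hJX hY hJS p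
    have c3 := metric_nablaEnd_cyclic hκ hJ hD hJX hJY hSs p
    have e : calibratedMetric κ J p (S p) (S p)
        = calibratedMetric κ J p (nablaEnd D J X Y p) (S p)
          + calibratedMetric κ J p (nablaEnd D J (J.apply X) (J.apply Y) p) (S p) :=
      congrArg (fun L ↦ L (S p)) (map_add (calibratedMetric κ J p) _ _)
    simp only [nablaEnd_apply_right hJ D _ hX, nablaEnd_apply_right hJ D _ hY,
      nablaEnd_apply_right hJ D _ hSs, Pi.neg_apply, map_neg, neg_apply, EndField.apply,
      calibratedMetric_apply_left hJ, hJ.square] at c0 c1 c2 c3 e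
    linarith
  have h1 := nablaEnd_apply_right hJ D (J.apply X) hY
  have h2 : J.apply (nablaEnd D J (J.apply X) Y) = nablaEnd D J X Y := by
    rw [h1] at hS
    rw [hS, ← sub_eq_add_neg, sub_eq_zero] at hS0
    exact hS0.symm
  rw [← h2, hJ.apply_apply, neg_neg]

/-- If `(∇_{Z̄} J)(∇_Z H) = 0` for the `(1,0)`-fields `Z = X - iJX` and `H = Y - iJY`, then
`(∇_X J) Y = 0`; the hypothesis is the real part of that equation. -/
lemma nablaEnd_eq_zero (hκ : IsSymplectic κ) (hJ : IsCalibrated κ J)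
    (hD : IsLeviCivita (calibratedMetric κ J) D) {X Y : VField E M}
    (hX : IsSmoothField X) (hY : IsSmoothField Y)
    (h : nablaEnd D J X (nabla D X Y - nabla D (J.apply X) (J.apply Y))
      + nablaEnd D J (J.apply X) (nabla D X (J.apply Y) + nabla D (J.apply X) Y) = 0) :
    nablaEnd D J X Y = 0 := by
  have hJX := hJ.smooth_apply hX
  have hu := smooth_nablaEnd hJ hD hX hY
  have ha := hD.smooth X Y hX hY
  have hb := hD.smooth _ Y hJX hY
  apply nablaEnd_eq_zero_of_sq hJ hD hX hY
  rw [nabla_apply, nabla_apply, nablaEnd_apply_left hκ hJ hD hX hY,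
    nablaEnd_apply_left hκ hJ hD hX ((hu.add (hJ.smooth_apply ha)).add hb),
    nablaEnd_sub_right hJ D X ha (((hJ.smooth_apply hu).neg).add (hJ.smooth_apply hb)),
    nablaEnd_add_right hJ D X (hJ.smooth_apply hu).neg (hJ.smooth_apply hb),
    nablaEnd_neg_right hJ D X (hJ.smooth_apply hu), nablaEnd_apply_right hJ D X hu,
    nablaEnd_apply_right hJ D X hb, nablaEnd_add_right hJ D X (hu.add (hJ.smooth_apply ha)) hb,
    nablaEnd_add_right hJ D X hu (hJ.smooth_apply ha), nablaEnd_apply_right hJ D X ha] at h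
  simp only [EndField.apply_add, EndField.apply_neg, hJ.apply_apply] at h
  -- The contributions of `∇_X Y` and `∇_{JX} Y` cancel between the two summands; what remains of
  -- `h` is `-2Ju = 0`.
  set u := nablaEnd D J X (nablaEnd D J X Y)
  have h2 : (2 : ℝ) • J.apply u = 0 := by
    rw [two_smul, ← neg_eq_zero, ← h]; abel
  have h3 : J.apply u = 0 := by simpa using h2
  have h4 := hJ.apply_apply u
  rw [h3, EndField.apply_zero] at h4
  exact neg_eq_zero.mp h4.symm

end AlmostKaehlerIdentities

section Complexification

/-! ### Complexified vectors -/

section Vectors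

variable {V : Type*} [AddCommGroup V] [Module ℝ V]

@[simp]
lemma rePart_tmul (c : ℂ) (v : V) : rePart (c ⊗ₜ[ℝ] v) = c.re • v := by
  simp [rePart]

@[simp]
lemma imPart_tmul (c : ℂ) (v : V) : imPart (c ⊗ₜ[ℝ] v) = c.im • v := by
  simp [imPart]

lemma tmul_rePart_add_tmul_imPart (z : ℂ ⊗[ℝ] V) :
    (1 : ℂ) ⊗ₜ[ℝ] rePart z + Complex.I ⊗ₜ[ℝ] imPart z = z := by
  induction z with
  | zero => simp
  | tmul c v =>
    simp only [rePart_tmul, imPart_tmul, ← TensorProduct.smul_tmul, ← TensorProduct.add_tmul]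
    congr 1
    apply Complex.ext <;> simp
  | add x y hx hy =>
    conv_rhs => rw [← hx, ← hy]
    simp only [map_add, TensorProduct.tmul_add]
    abel

lemma complexVector_ext {z w : ℂ ⊗[ℝ] V} (hre : rePart z = rePart w)
    (him : imPart z = imPart w) : z = w := by
  rw [← tmul_rePart_add_tmul_imPart z, hre, him, tmul_rePart_add_tmul_imPart]

lemma rePart_smul (c : ℂ) (z : ℂ ⊗[ℝ] V) :
    rePart (c • z) = c.re • rePart z - c.im • imPart z := by
  induction z with
  | zero => simp
  | tmul d v => simp [TensorProduct.smul_tmul', sub_smul, mul_smul]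
  | add x y hx hy => simp only [smul_add, map_add, hx, hy]; abel

lemma imPart_smul (c : ℂ) (z : ℂ ⊗[ℝ] V) :
    imPart (c • z) = c.re • imPart z + c.im • rePart z := by
  induction z with
  | zero => simp
  | tmul d v => simp [TensorProduct.smul_tmul', add_smul, mul_smul]
  | add x y hx hy => simp only [smul_add, map_add, hx, hy]; abel

lemma rePart_conjVec (z : ℂ ⊗[ℝ] V) : rePart (conjVec z) = rePart z := by
  induction z with
  | zero => simp
  | tmul d v => simp [conjVec]
  | add x y hx hy => simp only [map_add, hx, hy]

lemma imPart_conjVec (z : ℂ ⊗[ℝ] V) : imPart (conjVec z) = -imPart z := by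
  induction z with
  | zero => simp
  | tmul d v => simp [conjVec]
  | add x y hx hy => simp only [map_add, hx, hy]; abel

lemma rePart_baseChange (f : V →ₗ[ℝ] V) (z : ℂ ⊗[ℝ] V) :
    rePart (f.baseChange ℂ z) = f (rePart z) := by
  induction z with
  | zero => simp
  | tmul d v => simp
  | add x y hx hy => simp only [map_add, hx, hy]

lemma imPart_baseChange (f : V →ₗ[ℝ] V) (z : ℂ ⊗[ℝ] V) :
    imPart (f.baseChange ℂ z) = f (imPart z) := by
  induction z with
  | zero => simp
  | tmul d v => simp
  | add x y hx hy => simp only [map_add, hx, hy]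

end Vectors

/-! ### Complex vector fields -/

variable {E : Type*} [NormedAddCommGroup E] [NormedSpace ℝ E]
  {M : Type*} [TopologicalSpace M] [ChartedSpace E M]

namespace CField

lemma ext {Z W : CField E M} (hre : Z.re = W.re) (him : Z.im = W.im) : Z = W :=
  funext fun p ↦ complexVector_ext (congrFun hre p) (congrFun him p)

lemma re_mk (X Y : VField E M) : (mk X Y).re = X := by
  funext p; simp [re, mk]

lemma im_mk (X Y : VField E M) : (mk X Y).im = Y := by
  funext p; simp [im, mk]

lemma re_add (Z W : CField E M) : (Z + W).re = Z.re + W.re :=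
  funext fun _ ↦ map_add rePart _ _

lemma im_add (Z W : CField E M) : (Z + W).im = Z.im + W.im :=
  funext fun _ ↦ map_add imPart _ _

lemma re_neg (Z : CField E M) : (-Z).re = -Z.re := funext fun _ ↦ map_neg rePart _

lemma im_neg (Z : CField E M) : (-Z).im = -Z.im := funext fun _ ↦ map_neg imPart _

lemma re_sub (Z W : CField E M) : (Z - W).re = Z.re - W.re :=
  funext fun _ ↦ map_sub rePart _ _

lemma im_sub (Z W : CField E M) : (Z - W).im = Z.im - W.im :=
  funext fun _ ↦ map_sub imPart _ _

lemma re_zero : (0 : CField E M).re = 0 := funext fun _ ↦ map_zero rePart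

lemma im_zero : (0 : CField E M).im = 0 := funext fun _ ↦ map_zero imPart

lemma re_smul (c : ℂ) (Z : CField E M) : (c • Z).re = c.re • Z.re - c.im • Z.im :=
  funext fun _ ↦ rePart_smul c _

lemma im_smul (c : ℂ) (Z : CField E M) : (c • Z).im = c.re • Z.im + c.im • Z.re :=
  funext fun _ ↦ imPart_smul c _

lemma re_conj (Z : CField E M) : Z.conj.re = Z.re := funext fun _ ↦ rePart_conjVec _

lemma im_conj (Z : CField E M) : Z.conj.im = -Z.im := funext fun _ ↦ imPart_conjVec _

lemma re_cJ (J : EndField E M) (Z : CField E M) : (cJ J Z).re = J.apply Z.re :=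
  funext fun _ ↦ rePart_baseChange _ _

lemma im_cJ (J : EndField E M) (Z : CField E M) : (cJ J Z).im = J.apply Z.im :=
  funext fun _ ↦ imPart_baseChange _ _

lemma re_complexExt (F : VField E M → VField E M → VField E M) (Z W : CField E M) :
    (complexExt F Z W).re = F Z.re W.re - F Z.im W.im := re_mk _ _

lemma im_complexExt (F : VField E M → VField E M → VField E M) (Z W : CField E M) :
    (complexExt F Z W).im = F Z.re W.im + F Z.im W.re := im_mk _ _

end CField

lemma cJ_add (J : EndField E M) (Z W : CField E M) : cJ J (Z + W) = cJ J Z + cJ J W :=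
  funext fun _ ↦ map_add _ _ _

lemma cJ_neg (J : EndField E M) (Z : CField E M) : cJ J (-Z) = -cJ J Z :=
  funext fun _ ↦ map_neg _ _

lemma cJ_zero (J : EndField E M) : cJ J (0 : CField E M) = 0 :=
  funext fun _ ↦ map_zero _

lemma cJ_smul (J : EndField E M) (c : ℂ) (Z : CField E M) : cJ J (c • Z) = c • cJ J Z :=
  funext fun p ↦ ((J p).toLinearMap.baseChange ℂ).map_smul c (Z p)

lemma I_smul_I_smul (Z : CField E M) : Complex.I • Complex.I • Z = -Z := by
  rw [smul_smul, Complex.I_mul_I, neg_one_smul]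

variable [IsManifold 𝓘(ℝ, E) ∞ M]
  {κ : BilinField E M} {J : EndField E M} {D : Connection E M}

namespace CField.IsSmooth

variable {Z W : CField E M}

lemma add (hZ : Z.IsSmooth) (hW : W.IsSmooth) : (Z + W).IsSmooth :=
  ⟨by rw [re_add]; exact hZ.1.add hW.1, by rw [im_add]; exact hZ.2.add hW.2⟩

lemma sub (hZ : Z.IsSmooth) (hW : W.IsSmooth) : (Z - W).IsSmooth :=
  ⟨by rw [re_sub]; exact hZ.1.sub hW.1, by rw [im_sub]; exact hZ.2.sub hW.2⟩

lemma smul (c : ℂ) (hZ : Z.IsSmooth) : (c • Z).IsSmooth :=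
  ⟨by rw [re_smul]; exact (hZ.1.smul _).sub (hZ.2.smul _),
    by rw [im_smul]; exact (hZ.2.smul _).add (hZ.1.smul _)⟩

lemma conj (hZ : Z.IsSmooth) : Z.conj.IsSmooth :=
  ⟨by rw [re_conj]; exact hZ.1, by rw [im_conj]; exact hZ.2.neg⟩

lemma cJ (hJ : IsCalibrated κ J) (hZ : Z.IsSmooth) : (cJ J Z).IsSmooth :=
  ⟨by rw [re_cJ]; exact hJ.smooth_apply hZ.1, by rw [im_cJ]; exact hJ.smooth_apply hZ.2⟩

lemma zeroOnePart (hJ : IsCalibrated κ J) (hZ : Z.IsSmooth) : (zeroOnePart J Z).IsSmooth :=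
  (hZ.add ((hZ.cJ hJ).smul _)).smul _

lemma cnabla (hD : IsLeviCivita (calibratedMetric κ J) D) (hZ : Z.IsSmooth)
    (hW : W.IsSmooth) : (cnabla D Z W).IsSmooth :=
  ⟨by rw [Symplectic.cnabla, re_complexExt]
      exact (hD.smooth _ _ hZ.1 hW.1).sub (hD.smooth _ _ hZ.2 hW.2),
    by rw [Symplectic.cnabla, im_complexExt]
       exact (hD.smooth _ _ hZ.1 hW.2).add (hD.smooth _ _ hZ.2 hW.1)⟩

lemma nablaJ (hJ : IsCalibrated κ J) (hD : IsLeviCivita (calibratedMetric κ J) D)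
    (hZ : Z.IsSmooth) (hW : W.IsSmooth) : (nablaJ D J Z W).IsSmooth :=
  (hZ.cnabla hD (hW.cJ hJ)).sub ((hZ.cnabla hD hW).cJ hJ)

end CField.IsSmooth

open CField

lemma cJ_cJ (hJ : IsCalibrated κ J) (Z : CField E M) : cJ J (cJ J Z) = -Z :=
  CField.ext (by rw [re_cJ, re_cJ, hJ.apply_apply, re_neg])
    (by rw [im_cJ, im_cJ, hJ.apply_apply, im_neg])

lemma re_cnabla (D : Connection E M) (Z W : CField E M) :
    (cnabla D Z W).re = nabla D Z.re W.re - nabla D Z.im W.im := re_complexExt _ _ _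

lemma im_cnabla (D : Connection E M) (Z W : CField E M) :
    (cnabla D Z W).im = nabla D Z.re W.im + nabla D Z.im W.re := im_complexExt _ _ _

/-! ### Complex linearity of the extended connection and of `∇J`. -/

lemma cnabla_sub_left (D : Connection E M) (Z Z' W : CField E M) :
    cnabla D (Z - Z') W = cnabla D Z W - cnabla D Z' W := by
  apply CField.ext <;>
    simp only [re_cnabla, im_cnabla, re_sub, im_sub, nabla_sub_left] <;> abel

lemma cnabla_smul_I_left (D : Connection E M) (Z W : CField E M) :
    cnabla D (Complex.I • Z) W = Complex.I • cnabla D Z W := by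
  apply CField.ext <;>
    simp only [re_cnabla, im_cnabla, re_smul, im_smul, Complex.I_re, Complex.I_im, zero_smul,
      one_smul, zero_sub, zero_add, nabla_neg_left] <;> abel

lemma cnabla_add_right (D : Connection E M) (Z : CField E M) {W W' : CField E M}
    (hW : W.IsSmooth) (hW' : W'.IsSmooth) :
    cnabla D Z (W + W') = cnabla D Z W + cnabla D Z W' := by
  apply CField.ext <;>
    simp only [re_cnabla, im_cnabla, re_add, im_add, nabla_add_right D _ hW.1 hW'.1,
      nabla_add_right D _ hW.2 hW'.2] <;> abel

lemma cnabla_smul_right (D : Connection E M) (Z : CField E M) (c : ℂ) {W : CField E M}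
    (hW : W.IsSmooth) : cnabla D Z (c • W) = c • cnabla D Z W := by
  apply CField.ext <;>
    simp only [re_cnabla, im_cnabla, re_smul, im_smul,
      nabla_sub_right D _ (hW.1.smul _) (hW.2.smul _),
      nabla_add_right D _ (hW.2.smul _) (hW.1.smul _), nabla_smul_right D _ _ hW.1,
      nabla_smul_right D _ _ hW.2] <;> module

lemma cnabla_zero_right (D : Connection E M) (Z : CField E M) : cnabla D Z 0 = 0 := by
  have h (X : VField E M) : nabla D X 0 = 0 := by
    funext p; simp [nabla]
  apply CField.ext <;> simp [re_cnabla, im_cnabla, re_zero, im_zero, h]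

lemma cbracket_eq (hD : IsLeviCivita (calibratedMetric κ J) D) {Z W : CField E M}
    (hZ : Z.IsSmooth) (hW : W.IsSmooth) :
    cbracket Z W = cnabla D Z W - cnabla D W Z := by
  apply CField.ext <;>
    simp only [cbracket, re_complexExt, im_complexExt, re_sub, im_sub, re_cnabla, im_cnabla,
      ← hD.torsionFree _ _ hZ.1 hW.1, ← hD.torsionFree _ _ hZ.2 hW.2,
      ← hD.torsionFree _ _ hZ.1 hW.2, ← hD.torsionFree _ _ hZ.2 hW.1] <;> abel

/-- Transfers the real identities for `∇J` to complex fields. -/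
lemma nablaJ_eq_complexExt (D : Connection E M) (J : EndField E M) (Z W : CField E M) :
    nablaJ D J Z W = complexExt (nablaEnd D J) Z W := by
  apply CField.ext <;>
    simp only [nablaJ, re_complexExt, im_complexExt, re_sub, im_sub, re_cnabla, im_cnabla, re_cJ,
      im_cJ, nablaEnd, EndField.apply_sub, EndField.apply_add] <;> abel

lemma nablaJ_smul_I_left (D : Connection E M) (J : EndField E M) (Z W : CField E M) :
    nablaJ D J (Complex.I • Z) W = Complex.I • nablaJ D J Z W := by
  simp only [nablaJ, cnabla_smul_I_left, cJ_smul, smul_sub]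

lemma nablaJ_smul_right (hJ : IsCalibrated κ J) (D : Connection E M) (Z : CField E M)
    (c : ℂ) {W : CField E M} (hW : W.IsSmooth) :
    nablaJ D J Z (c • W) = c • nablaJ D J Z W := by
  simp only [nablaJ, cJ_smul, cnabla_smul_right D _ _ hW, cnabla_smul_right D _ _ (hW.cJ hJ),
    smul_sub]

lemma nablaJ_add_right (hJ : IsCalibrated κ J) (D : Connection E M) (Z : CField E M)
    {W W' : CField E M} (hW : W.IsSmooth) (hW' : W'.IsSmooth) :
    nablaJ D J Z (W + W') = nablaJ D J Z W + nablaJ D J Z W' := by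
  simp only [nablaJ, cJ_add, cnabla_add_right D _ hW hW',
    cnabla_add_right D _ (hW.cJ hJ) (hW'.cJ hJ)]
  abel

lemma nablaJ_cJ_right (hJ : IsCalibrated κ J) (D : Connection E M) (Z : CField E M)
    {W : CField E M} (hW : W.IsSmooth) : nablaJ D J Z (cJ J W) = -cJ J (nablaJ D J Z W) := by
  simp only [nablaJ_eq_complexExt]
  apply CField.ext <;>
    simp only [re_complexExt, im_complexExt, re_neg, im_neg, re_cJ, im_cJ,
      nablaEnd_apply_right hJ D _ hW.1, nablaEnd_apply_right hJ D _ hW.2, EndField.apply_sub,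
      EndField.apply_add] <;> abel

lemma nablaJ_cJ_left (hκ : IsSymplectic κ) (hJ : IsCalibrated κ J)
    (hD : IsLeviCivita (calibratedMetric κ J) D) {Z W : CField E M}
    (hZ : Z.IsSmooth) (hW : W.IsSmooth) :
    nablaJ D J (cJ J Z) W = -cJ J (nablaJ D J Z W) := by
  simp only [nablaJ_eq_complexExt]
  apply CField.ext <;>
    simp only [re_complexExt, im_complexExt, re_neg, im_neg, re_cJ, im_cJ,
      nablaEnd_apply_left hκ hJ hD hZ.1 hW.1, nablaEnd_apply_left hκ hJ hD hZ.1 hW.2,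
      nablaEnd_apply_left hκ hJ hD hZ.2 hW.1, nablaEnd_apply_left hκ hJ hD hZ.2 hW.2,
      EndField.apply_sub, EndField.apply_add] <;> abel

end Complexification

section OneZero

/-! ### Vector fields of type `(1,0)` -/

open CField

variable {E : Type*} [NormedAddCommGroup E] [NormedSpace ℝ E]
  {M : Type*} [TopologicalSpace M] [ChartedSpace E M] [IsManifold 𝓘(ℝ, E) ∞ M]
  {κ : BilinField E M} {J : EndField E M} {D : Connection E M}

lemma IsOneZero.cJ_eq {Z : CField E M} (hZ : IsOneZero J Z) : cJ J Z = Complex.I • Z :=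
  funext hZ.2

lemma IsOneZero.cJ_conj {Z : CField E M} (hZ : IsOneZero J Z) :
    cJ J Z.conj = -(Complex.I • Z.conj) := by
  have h := hZ.cJ_eq
  have hre := congrArg CField.re h
  have him := congrArg CField.im h
  simp only [re_cJ, im_cJ, re_smul, im_smul, Complex.I_re, Complex.I_im, zero_smul, one_smul,
    zero_sub, zero_add] at hre him
  apply CField.ext <;>
    simp only [re_cJ, im_cJ, re_neg, im_neg, re_smul, im_smul, re_conj, im_conj, Complex.I_re,
      Complex.I_im, zero_smul, one_smul, zero_sub, zero_add, EndField.apply_neg, hre, him, neg_neg]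

lemma isOneZero_mk (hJ : IsCalibrated κ J) {X : VField E M} (hX : IsSmoothField X) :
    IsOneZero J (CField.mk X (-J.apply X)) := by
  refine ⟨⟨by rwa [re_mk], by rw [im_mk]; exact (hJ.smooth_apply hX).neg⟩, congrFun ?_⟩
  change _ = Complex.I • CField.mk X (-J.apply X)
  apply CField.ext <;>
    simp only [re_cJ, im_cJ, re_smul, im_smul, re_mk, im_mk, Complex.I_re,
      Complex.I_im, zero_smul, one_smul, zero_sub, zero_add, EndField.apply_neg, hJ.apply_apply,
      neg_neg]

lemma IsOneZero.zeroOnePart_conj {Z : CField E M} (hZ : IsOneZero J Z) :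
    zeroOnePart J Z.conj = Z.conj := by
  rw [zeroOnePart, hZ.cJ_conj, smul_neg, I_smul_I_smul, neg_neg, ← two_smul ℂ, smul_smul]
  norm_num

/-- If the `(1,0)`-part of `∇_{Z̄} Y` vanishes for a field `Y` of type `(0,1)`, then
`(∇_{Z̄} J) Y = 0`. -/
lemma nablaJ_eq_zero_of_cnabla {Z Y : CField E M} (hY : Y.IsSmooth)
    (hY01 : cJ J Y = -(Complex.I • Y)) (h : cJ J (cnabla D Z Y) = -(Complex.I • cnabla D Z Y)) :
    nablaJ D J Z Y = 0 := by
  rw [nablaJ, h, hY01, ← neg_smul, cnabla_smul_right D _ _ hY, neg_smul, sub_self]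

/-! ### Conditions 1 and 2 when `J` is parallel. -/

lemma nablaBarBVanishes_of_nablaJ (hJ : IsCalibrated κ J)
    (hD : IsLeviCivita (calibratedMetric κ J) D)
    (h : ∀ Z W : CField E M, Z.IsSmooth → W.IsSmooth → nablaJ D J Z W = 0) :
    NablaBarBVanishes D J := by
  have hB {Z W : CField E M} (hZ : Z.IsSmooth) (hW : W.IsSmooth) : tensorB D J Z W = 0 := by
    rw [tensorB, h _ _ hZ hW, h _ _ (hZ.cJ hJ) hW, cJ_zero, sub_zero]
  intro U Z W hU hZ hW
  have hU' := hU.zeroOnePart hJ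
  rw [nablaB, hB hZ hW, hB (hU'.cnabla hD hZ) hW, hB hZ (hU'.cnabla hD hW), cnabla_zero_right,
    sub_zero, sub_zero]

lemma curvature_formula_of_nablaJ (hD : IsLeviCivita (calibratedMetric κ J) D)
    (h : ∀ Z W : CField E M, Z.IsSmooth → W.IsSmooth → nablaJ D J Z W = 0) {Z W H : CField E M}
    (hZ : IsOneZero J Z) (hW : IsOneZero J W) (hH : IsOneZero J H) :
    curvature D Z.conj W H =
      -(Complex.I • cnabla D Z.conj (cJ J (cnabla D W H)))
        + Complex.I • cJ J (cnabla D W (cnabla D Z.conj H))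
        + Complex.I • cJ J (cnabla D (cnabla D Z.conj W) H)
        + cnabla D (cnabla D W Z.conj) H := by
  -- A parallel `J` makes `∇_U` preserve type (1,0) for every complex `U`, so each `J` in the
  -- formula acts as `i` and the formula becomes the definition of curvature for a torsion-free
  -- connection.
  have key {U V : CField E M} (hU : U.IsSmooth) (hV : IsOneZero J V) :
      IsOneZero J (cnabla D U V) := by
    refine ⟨hU.cnabla hD hV.1, congrFun ?_⟩
    have h0 := h U V hU hV.1
    rw [nablaJ, hV.cJ_eq, cnabla_smul_right D _ _ hV.1, sub_eq_zero] at h0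
    exact h0.symm
  have hWH := key hW.1 hH
  have hZH := key hZ.1.conj hH
  rw [curvature, cbracket_eq hD hZ.1.conj hW.1, cnabla_sub_left, hWH.cJ_eq,
    (key hW.1 hZH).cJ_eq, (key (key hZ.1.conj hW).1 hH).cJ_eq, cnabla_smul_right D _ _ hWH.1,
    I_smul_I_smul, I_smul_I_smul, I_smul_I_smul]
  abel

/-! ### Types of `∇J` on an almost Kähler manifold, and the passage between condition 3 and the
others. -/

section AlmostKaehler

variable (hκ : IsSymplectic κ) (hJ : IsCalibrated κ J)
  (hD : IsLeviCivita (calibratedMetric κ J) D)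

include hκ hJ hD

lemma IsOneZero.cJ_nablaJ {Z W : CField E M} (hZ : IsOneZero J Z) (hW : W.IsSmooth) :
    cJ J (nablaJ D J Z W) = -(Complex.I • nablaJ D J Z W) := by
  have h := nablaJ_cJ_left hκ hJ hD hZ.1 hW
  rw [hZ.cJ_eq, nablaJ_smul_I_left] at h
  rw [h, neg_neg]

lemma IsOneZero.cJ_nablaJ_conj {Z W : CField E M} (hZ : IsOneZero J Z) (hW : W.IsSmooth) :
    cJ J (nablaJ D J Z.conj W) = Complex.I • nablaJ D J Z.conj W := by
  have h := nablaJ_cJ_left hκ hJ hD hZ.1.conj hW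
  have h2 : Z.conj = Complex.I • cJ J Z.conj := by
    rw [hZ.cJ_conj, smul_neg, I_smul_I_smul, neg_neg]
  conv_lhs => rw [h2, nablaJ_smul_I_left, h, smul_neg, cJ_neg, cJ_smul, cJ_cJ hJ, smul_neg,
    neg_neg]

/-- The value has type (1,0) because of `Z̄`, and type (0,1) because `∇_{Z̄}J` anticommutes with
`J`. -/
lemma IsOneZero.nablaJ_conj_eq_zero {Z W : CField E M} (hZ : IsOneZero J Z)
    (hW : IsOneZero J W) : nablaJ D J Z.conj W = 0 := by
  have h := nablaJ_cJ_right hJ D Z.conj hW.1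
  rw [hW.cJ_eq, nablaJ_smul_right hJ D _ _ hW.1, hZ.cJ_nablaJ_conj hκ hJ hD hW.1,
    eq_neg_iff_add_eq_zero, ← two_smul ℂ, smul_smul] at h
  exact (smul_eq_zero.mp h).resolve_left (by simp)

lemma IsOneZero.cnabla_conj {Z W : CField E M} (hZ : IsOneZero J Z) (hW : IsOneZero J W) :
    IsOneZero J (cnabla D Z.conj W) := by
  refine ⟨hZ.1.conj.cnabla hD hW.1, congrFun ?_⟩
  have h := hZ.nablaJ_conj_eq_zero hκ hJ hD hW
  rw [nablaJ, hW.cJ_eq, cnabla_smul_right D _ _ hW.1, sub_eq_zero] at h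
  exact h.symm

/-- `V + iJV` is twice the (0,1)-part of `V`, and `∇_{Z̄}J` does not see the (1,0)-part. -/
lemma IsOneZero.nablaJ_conj_of_zeroOne {Z V : CField E M} (hZ : IsOneZero J Z)
    (hV : V.IsSmooth) (h : nablaJ D J Z.conj (V + Complex.I • cJ J V) = 0) :
    nablaJ D J Z.conj V = 0 := by
  rw [nablaJ_add_right hJ D _ hV ((hV.cJ hJ).smul _),
    nablaJ_smul_right hJ D _ _ (hV.cJ hJ), nablaJ_cJ_right hJ D _ hV,
    hZ.cJ_nablaJ_conj hκ hJ hD hV, smul_neg, I_smul_I_smul, neg_neg, ← two_smul ℂ] at h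
  exact (smul_eq_zero.mp h).resolve_left two_ne_zero

lemma IsOneZero.tensorB_eq {Z W : CField E M} (hZ : IsOneZero J Z) (hW : W.IsSmooth) :
    tensorB D J Z W = (-2 * Complex.I) • nablaJ D J Z W := by
  rw [tensorB, hZ.cJ_eq, nablaJ_smul_I_left, hZ.cJ_nablaJ hκ hJ hD hW]
  module

/-- The vanishing of `(∇_{Z̄} J)(∇_W H)` on fields of type `(1,0)` forces `∇J = 0`. -/
lemma nablaJ_eq_zero
    (h : ∀ Z W H : CField E M, IsOneZero J Z → IsOneZero J W → IsOneZero J H →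
      nablaJ D J Z.conj (cnabla D W H) = 0)
    {Z W : CField E M} (hZ : Z.IsSmooth) (hW : W.IsSmooth) : nablaJ D J Z W = 0 := by
  have key {X Y : VField E M} (hX : IsSmoothField X) (hY : IsSmoothField Y) :
      nablaEnd D J X Y = 0 := by
    apply nablaEnd_eq_zero hκ hJ hD hX hY
    -- Taking `W = Z` is enough: it makes `∇_X J` appear squared.
    have h1 := congrArg CField.re
      (h _ _ _ (isOneZero_mk hJ hX) (isOneZero_mk hJ hX) (isOneZero_mk hJ hY))
    have hJX := hJ.smooth_apply hX
    have hJY := hJ.smooth_apply hY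
    rw [nablaJ_eq_complexExt, re_complexExt, re_conj, im_conj, re_cnabla, im_cnabla, re_zero] at h1
    simp only [re_mk, im_mk, neg_neg, nabla_neg_left, nabla_neg_right D _ hJY] at h1
    rw [← neg_add, nablaEnd_neg_right hJ D _
      ((hD.smooth _ _ hX hJY).add (hD.smooth _ _ hJX hY)), sub_neg_eq_add] at h1
    exact h1
  rw [nablaJ_eq_complexExt]
  apply CField.ext <;>
    simp [re_complexExt, im_complexExt, re_zero, im_zero, key hZ.1 hW.1, key hZ.1 hW.2,
      key hZ.2 hW.1, key hZ.2 hW.2]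

/-- Since `B(W,H) = -2i(∇_W J)H` on type (1,0), condition 1 expresses `∇_{Z̄}((∇_W J)H)` through
`(∇_{∇_{Z̄}W} J)H` and `(∇_W J)(∇_{Z̄}H)`, both of type (0,1). -/
lemma nablaJ_conj_cnabla_of_nablaBarB (h : NablaBarBVanishes D J) {Z W H : CField E M}
    (hZ : IsOneZero J Z) (hW : IsOneZero J W) (hH : IsOneZero J H) :
    nablaJ D J Z.conj (cnabla D W H) = 0 := by
  have hN := hW.1.nablaJ hJ hD hH.1
  have h1 := h Z.conj W H hZ.1.conj hW.1 hH.1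
  have hZW := hZ.cnabla_conj hκ hJ hD hW
  have hZH := hZ.1.conj.cnabla hD hH.1
  rw [nablaB, hZ.zeroOnePart_conj, hW.tensorB_eq hκ hJ hD hH.1, hZW.tensorB_eq hκ hJ hD hH.1,
    hW.tensorB_eq hκ hJ hD hZH, sub_sub, sub_eq_zero] at h1
  -- Twice the (0,1)-part of `∇_W H`, computed using `JH = iH`.
  have hV : cnabla D W H + Complex.I • cJ J (cnabla D W H)
      = -(Complex.I • nablaJ D J W H) := by
    rw [nablaJ, hH.cJ_eq, cnabla_smul_right D _ _ hH.1, smul_sub, I_smul_I_smul]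
    abel
  apply hZ.nablaJ_conj_of_zeroOne hκ hJ hD (hW.1.cnabla hD hH.1)
  rw [hV, ← neg_smul, nablaJ_smul_right hJ D _ _ hN, smul_eq_zero]
  refine Or.inr (nablaJ_eq_zero_of_cnabla hN (hW.cJ_nablaJ hκ hJ hD hH.1) ?_)
  rw [cnabla_smul_right D _ _ hN, ← smul_add] at h1
  rw [smul_right_injective _ (by simp) h1, cJ_add, hZW.cJ_nablaJ hκ hJ hD hH.1,
    hW.cJ_nablaJ hκ hJ hD hZH, smul_add, neg_add]

/-- With `V = ∇_W H` and `P = ∇_W ∇_{Z̄} H + ∇_{∇_{Z̄}W} H`, torsion-freeness turns the formula into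
`∇_{Z̄}(V + iJV) = P + iJP`, whose right side is of type (0,1). -/
lemma nablaJ_conj_cnabla_of_curvature_formula {Z W H : CField E M}
    (hZ : IsOneZero J Z) (hW : IsOneZero J W) (hH : IsOneZero J H)
    (h : curvature D Z.conj W H =
      -(Complex.I • cnabla D Z.conj (cJ J (cnabla D W H)))
        + Complex.I • cJ J (cnabla D W (cnabla D Z.conj H))
        + Complex.I • cJ J (cnabla D (cnabla D Z.conj W) H)
        + cnabla D (cnabla D W Z.conj) H) :
    nablaJ D J Z.conj (cnabla D W H) = 0 := by
  have hV := hW.1.cnabla hD hH.1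
  apply hZ.nablaJ_conj_of_zeroOne hκ hJ hD hV
  rw [curvature, cbracket_eq hD hZ.1.conj hW.1, cnabla_sub_left] at h
  have h1 : cnabla D Z.conj (cnabla D W H + Complex.I • cJ J (cnabla D W H))
      = (cnabla D W (cnabla D Z.conj H) + cnabla D (cnabla D Z.conj W) H)
        + Complex.I • cJ J (cnabla D W (cnabla D Z.conj H) + cnabla D (cnabla D Z.conj W) H) := by
    rw [cnabla_add_right D _ hV ((hV.cJ hJ).smul _), cnabla_smul_right D _ _ (hV.cJ hJ), cJ_add,
      smul_add]
    rw [sub_eq_iff_eq_add, sub_eq_iff_eq_add] at h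
    rw [h]
    abel
  have h01 (U : CField E M) :
      cJ J (U + Complex.I • cJ J U) = -(Complex.I • (U + Complex.I • cJ J U)) := by
    rw [cJ_add, cJ_smul, cJ_cJ hJ, smul_add, I_smul_I_smul, smul_neg]
    abel
  refine nablaJ_eq_zero_of_cnabla (hV.add ((hV.cJ hJ).smul _)) (h01 _) ?_
  rw [h1, h01]

end AlmostKaehler

end OneZero

end Symplectic

end

open Symplectic in
theorem lemma3 (n : ℕ) {M : Type*} [TopologicalSpace M] [T2Space M] [SigmaCompactSpace M]
    [ChartedSpace (EuclideanSpace ℝ (Fin (2 * n))) M]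
    [IsManifold 𝓘(ℝ, EuclideanSpace ℝ (Fin (2 * n))) ∞ M]
    (κ : BilinField (EuclideanSpace ℝ (Fin (2 * n))) M) (hκ : IsSymplectic κ)
    (J : EndField (EuclideanSpace ℝ (Fin (2 * n))) M) (hJ : IsCalibrated κ J)
    (D : Connection (EuclideanSpace ℝ (Fin (2 * n))) M)
    (hD : IsLeviCivita (calibratedMetric κ J) D) :
    List.TFAE [
      NablaBarBVanishes D J,
      ∀ Z W H : CField (EuclideanSpace ℝ (Fin (2 * n))) M,
        IsOneZero J Z → IsOneZero J W → IsOneZero J H →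
        curvature D Z.conj W H =
          -(Complex.I • cnabla D Z.conj (cJ J (cnabla D W H)))
            + Complex.I • cJ J (cnabla D W (cnabla D Z.conj H))
            + Complex.I • cJ J (cnabla D (cnabla D Z.conj W) H)
            + cnabla D (cnabla D W Z.conj) H,
      ∀ Z W H : CField (EuclideanSpace ℝ (Fin (2 * n))) M,
        IsOneZero J Z → IsOneZero J W → IsOneZero J H →
        nablaJ D J Z.conj (cnabla D W H) = 0] := by
  tfae_have 1 → 3 := fun h Z W H hZ hW hH ↦
    nablaJ_conj_cnabla_of_nablaBarB hκ hJ hD h hZ hW hH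
  tfae_have 3 → 1 := fun h ↦
    nablaBarBVanishes_of_nablaJ hJ hD fun _ _ hZ hW ↦ nablaJ_eq_zero hκ hJ hD h hZ hW
  tfae_have 2 → 3 := fun h Z W H hZ hW hH ↦
    nablaJ_conj_cnabla_of_curvature_formula hκ hJ hD hZ hW hH (h Z W H hZ hW hH)
  tfae_have 3 → 2 := fun h Z W H hZ hW hH ↦
    curvature_formula_of_nablaJ hD (fun _ _ hZ hW ↦ nablaJ_eq_zero hκ hJ hD h hZ hW) hZ hW hH
  tfae_finish
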